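/- All groups are finite. For a group $G$, a set of elements of $G$ is non-commuting if any two distinct elements of it do not commute; $nc(G)$ is the maximum size of a non-commuting set in $G$, and $NC(G)$ is the simplicial complex whose vertices are the nontrivial elements of $G$ and whose simplices are the nonempty non-commuting sets of nontrivial elements. Let $G$ be a Frobenius group with Frobenius complement $H$ and Frobenius kernel $K$; that is, $H$ is a proper nontrivial subgroup of $G$ with $H\cap gHg^{-1}=1$ for all $g\in G\setminus H$, and $K$ is the subgroup $K=G\setminus\bigcup_{g\in G}(gHg^{-1}\setminus\{1\})$. Then: (1) $NC(G)$ is isomorphic, as a simplicial complex, to the simplicial join $NC(K) * NC(H) * \cdots * NC(H)$ of $NC(K)$ with $|K|$ copies of $NC(H)$. (2) $nc(G)=nc(K)+|K|\cdot nc(H)$. (3) If both $H$ and $K$ are abelian, then the geometric realization of $NC(G)$ is homotopy equivalent to a wedge of $(|K|-2)(|H|-2)^{|K|}$ spheres of dimension $|K|$, where the wedge of zero spheres is a point. -/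

import Mathlib

/-! ## Abstract simplicial complexes: joins, isomorphisms, geometric realization -/

namespace AbstractSimplicialComplex

/-- The simplicial join `X * Y`: its vertex set is the disjoint union of the two vertex sets, and a
nonempty finite set of vertices is a face iff its part in `X` is empty or a face of `X` and its
part in `Y` is empty or a face of `Y`. -/
def join {V W : Type*} (X : AbstractSimplicialComplex V) (Y : AbstractSimplicialComplex W) :
    AbstractSimplicialComplex (V ⊕ W) where
  faces := {s | s.Nonempty ∧ (s.toLeft = ∅ ∨ s.toLeft ∈ X.faces) ∧
    (s.toRight = ∅ ∨ s.toRight ∈ Y.faces)}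
  isRelLowerSet_faces := by
    rintro s ⟨hs, h1, h2⟩
    refine ⟨hs, fun t hts ht => ⟨ht, ?_, ?_⟩⟩
    · have hsub : t.toLeft ⊆ s.toLeft := fun v hv => by simpa using hts (by simpa using hv)
      rcases t.toLeft.eq_empty_or_nonempty with h | h
      · exact Or.inl h
      · rcases h1 with h1 | h1
        · exact Or.inl (Finset.subset_empty.1 (h1 ▸ hsub))
        · exact Or.inr ((X.isRelLowerSet_faces h1).2 hsub h)
    · have hsub : t.toRight ⊆ s.toRight := fun v hv => by simpa using hts (by simpa using hv)
      rcases t.toRight.eq_empty_or_nonempty with h | h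
      · exact Or.inl h
      · rcases h2 with h2 | h2
        · exact Or.inl (Finset.subset_empty.1 (h2 ▸ hsub))
        · exact Or.inr ((Y.isRelLowerSet_faces h2).2 hsub h)
  singleton_mem := by
    rintro (v | w)
    · refine ⟨by simp, Or.inr ?_, Or.inl (by ext; simp)⟩
      have : ({Sum.inl v} : Finset (V ⊕ W)).toLeft = {v} := by ext; simp
      exact this ▸ X.singleton_mem v
    · refine ⟨by simp, Or.inl (by ext; simp), Or.inr ?_⟩
      have : ({Sum.inr w} : Finset (V ⊕ W)).toRight = {w} := by ext; simp
      exact this ▸ Y.singleton_mem w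

/-- The part in the `i`-th copy of `V` of a finite subset of the disjoint union of `n` copies. -/
noncomputable def slice {V : Type*} {n : ℕ} (s : Finset (Fin n × V)) (i : Fin n) : Finset V :=
  s.preimage (fun v => (i, v)) (fun _ _ _ _ h => (Prod.mk.inj h).2)

theorem mem_slice {V : Type*} {n : ℕ} (s : Finset (Fin n × V)) (i : Fin n) (v : V) :
    v ∈ slice s i ↔ (i, v) ∈ s :=
  Finset.mem_preimage

/-- The `n`-fold join of a complex `X` with itself: its vertex set is the disjoint union of `n`
copies of that of `X`, and a nonempty finite set of vertices is a face iff its part in each copy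
is empty or a face of that copy. -/
def joinPow {V : Type*} (X : AbstractSimplicialComplex V) (n : ℕ) :
    AbstractSimplicialComplex (Fin n × V) where
  faces := {s | s.Nonempty ∧ ∀ i, slice s i = ∅ ∨ slice s i ∈ X.faces}
  isRelLowerSet_faces := by
    rintro s ⟨hs, h⟩
    refine ⟨hs, fun t hts ht => ⟨ht, fun i => ?_⟩⟩
    have hsub : slice t i ⊆ slice s i := fun v hv =>
      (mem_slice s i v).2 (hts ((mem_slice t i v).1 hv))
    rcases (slice t i).eq_empty_or_nonempty with h' | h'
    · exact Or.inl h'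
    · rcases h i with h | h
      · exact Or.inl (Finset.subset_empty.1 (h ▸ hsub))
      · exact Or.inr ((X.isRelLowerSet_faces h).2 hsub h')
  singleton_mem := by
    rintro ⟨i, v⟩
    refine ⟨by simp, fun j => ?_⟩
    by_cases hj : j = i
    · subst hj
      have : slice {(j, v)} j = {v} := by ext; simp [mem_slice]
      exact Or.inr (this ▸ X.singleton_mem v)
    · exact Or.inl (by ext; simp [mem_slice, hj])

/-- A simplicial isomorphism: a bijection of the vertex sets under which the faces correspond. -/
structure Iso {V W : Type*} (X : AbstractSimplicialComplex V) (Y : AbstractSimplicialComplex W)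
    where
  /-- the bijection between the vertex sets -/
  toEquiv : V ≃ W
  map_mem_faces_iff : ∀ s : Finset V, s.map toEquiv.toEmbedding ∈ Y.faces ↔ s ∈ X.faces

/-- The geometric realization of a simplicial complex on a finite vertex set, in barycentric
coordinates: the points of `V → ℝ` that are convex combinations of the vertices of some face,
with the subspace topology. -/
def realization {V : Type*} [Finite V] (X : AbstractSimplicialComplex V) : Set (V → ℝ) :=
  {w | (∀ v, 0 ≤ w v) ∧ ∃ s ∈ X.faces, (∀ v, v ∉ s → w v = 0) ∧ ∑ v ∈ s, w v = 1}

end AbstractSimplicialComplex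

/-! ## Wedges of spheres -/

/-- The relation that glues the base points `x i` of a family of spaces to one extra point. -/
inductive WedgeRel {I : Type*} {X : I → Type*} (x : ∀ i, X i) :
    Unit ⊕ (Σ i, X i) → Unit ⊕ (Σ i, X i) → Prop
  | glue (i : I) : WedgeRel x (Sum.inr ⟨i, x i⟩) (Sum.inl ())

/-- The wedge of a family of pointed spaces, with the quotient topology. The extra point becomes
the common base point, so that the empty wedge is a point. -/
abbrev Wedge {I : Type*} {X : I → Type*} (x : ∀ i, X i) : Type _ :=
  Quot (WedgeRel x)

/-- The standard `d`-sphere in `(d+1)`-dimensional Euclidean space. -/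
abbrev StdSphere (d : ℕ) : Type :=
  Metric.sphere (0 : EuclideanSpace ℝ (Fin (d + 1))) 1

/-- The base point `(1, 0, …, 0)` of the standard sphere. -/
noncomputable def StdSphere.base (d : ℕ) : StdSphere d :=
  ⟨EuclideanSpace.single 0 1, by simp⟩

/-- The wedge of `N` copies of the standard `d`-sphere. -/
abbrev WedgeOfSpheres (N d : ℕ) : Type :=
  Wedge (fun _ : Fin N => StdSphere.base d)

/-! ## Non-commuting sets and the non-commuting complex -/

/-- A set of elements of a group is non-commuting if its distinct elements pairwise do not
commute. -/
def IsNonCommuting {G : Type*} [Group G] (s : Finset G) : Prop :=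
  (s : Set G).Pairwise fun a b => ¬ Commute a b

/-- The non-commuting complex `NC(G)`: its vertices are the nontrivial elements of `G` and its
faces are the nonempty finite non-commuting sets of nontrivial elements. -/
def NC (G : Type*) [Group G] : AbstractSimplicialComplex {g : G // g ≠ 1} where
  faces := {s | s.Nonempty ∧ IsNonCommuting (s.map (Function.Embedding.subtype _))}
  isRelLowerSet_faces := by
    rintro s ⟨hs, h⟩
    refine ⟨hs, fun t hts ht => ⟨ht, ?_⟩⟩
    exact Set.Pairwise.mono (Finset.coe_subset.2 (Finset.map_subset_map.2 hts)) h
  singleton_mem := by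
    intro v
    simp [IsNonCommuting]

/-- `nc(G)`: the largest size of a non-commuting set in the finite group `G`. -/
noncomputable def nc (G : Type*) [Group G] [Finite G] : ℕ :=
  sSup {n | ∃ s : Finset G, IsNonCommuting s ∧ s.card = n}

/-! ## Frobenius groups -/

/-- The conjugate `g H g⁻¹` of a subgroup. -/
def conjSubgroup {G : Type*} [Group G] (g : G) (H : Subgroup G) : Subgroup G :=
  H.map (MulAut.conj g).toMonoidHom

/-- `H` is a Frobenius complement in `G`: a proper nontrivial subgroup that meets its conjugate by
any element outside `H` trivially. -/
structure IsFrobeniusComplement {G : Type*} [Group G] (H : Subgroup G) : Prop where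
  ne_bot : H ≠ ⊥
  ne_top : H ≠ ⊤
  inf_conj : ∀ g : G, g ∉ H → H ⊓ conjSubgroup g H = ⊥

/-- `K` is the Frobenius kernel belonging to `H`: it consists of the elements of `G` that are not
nontrivial elements of a conjugate of `H`. -/
def IsFrobeniusKernel {G : Type*} [Group G] (H K : Subgroup G) : Prop :=
  (K : Set G) = Set.univ \ ⋃ g : G, ((conjSubgroup g H : Set G) \ {1})

/-! The nontrivial elements of G fall into blocks: those of K, and those of the conjugates tHt⁻¹,
one for each coset of H; counting them gives |G : H| = |K|. An element commuting with a nontrivial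
element of a conjugate of H lies in that conjugate, so elements of different blocks never commute
(`exists_blockEquiv`). Hence a set is non-commuting iff its trace on each block is. This gives the
join decomposition, and the maximal sizes add up.

If H and K are abelian, two nontrivial elements commute iff they share a block, so `NC G` is a
complete multipartite complex with |K| + 1 blocks. Fix a vertex `e i` in each block and give a point
signed coordinates: weight at `e i` counts positively, weight at other vertices of block `i`
negatively. A choice `f` of vertices with `f i ≠ e i` for all `i` spans together with `e` a
cross-polytope, that is, a sphere; such choices index the wedge.

The map `flow` on nonzero vectors starts at the identity and ends by sending everything outside the
open negative orthant to the ray of the first basis vector. It never makes a nonnegative coordinate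
negative, so it lifts to the complex (`pointFlow`). At time 1 only the open simplices on the choices
`f` survive, each contributing one sphere. In `nonempty_points_homotopyEquiv` the maps `glue` and
`collapseFun` are homotopy inverse because their composites are the time-1 flows on the complex and
on the wedge. -/

/-! ## A flow on nonzero vectors that collapses all but the negative orthant -/

namespace OrthantFlow

variable {d : ℕ}

/-- The total spread of the negative parts of the coordinates of `x`. -/
noncomputable def spread (x : Fin (d + 1) → ℝ) : ℝ :=
  ∑ i, ∑ j, |max (-x i) 0 - max (-x j) 0|

/-- The vector `x`, translated by `t` times its spread in every coordinate. -/
noncomputable def shifted (t : ℝ) (x : Fin (d + 1) → ℝ) : Fin (d + 1) → ℝ :=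
  fun i => x i + t * spread x

/-- The sum of the negative parts of the coordinates. -/
noncomputable def negSum (y : Fin (d + 1) → ℝ) : ℝ := ∑ i, max (-y i) 0

/-- The sum of the positive parts of the coordinates. -/
noncomputable def posSum (y : Fin (d + 1) → ℝ) : ℝ := ∑ i, max (y i) 0

/-- The linear coefficient of the flow. -/
noncomputable def scale (t : ℝ) (x : Fin (d + 1) → ℝ) : ℝ := 1 - t + t * negSum (shifted t x)

/-- The nonnegative translation part of the flow. -/
noncomputable def push (t : ℝ) (x : Fin (d + 1) → ℝ) (i : Fin (d + 1)) : ℝ :=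
  scale t x * (t * spread x) + if i = 0 then t * posSum (shifted t x) else 0

/-- The flow: at time `0` it is the identity, at time `1` every vector with a nonnegative
coordinate goes to a positive multiple of the first basis vector. -/
noncomputable def flow (t : ℝ) (x : Fin (d + 1) → ℝ) (i : Fin (d + 1)) : ℝ :=
  scale t x * x i + push t x i

/-- The sum of the absolute values of the coordinates. -/
noncomputable def absSum (x : Fin (d + 1) → ℝ) : ℝ := ∑ i, |x i|

theorem spread_nonneg (x : Fin (d + 1) → ℝ) : 0 ≤ spread x :=
  Finset.sum_nonneg fun _ _ => Finset.sum_nonneg fun _ _ => abs_nonneg _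

theorem negSum_nonneg (x : Fin (d + 1) → ℝ) : 0 ≤ negSum x :=
  Finset.sum_nonneg fun _ _ => le_max_right _ _

theorem posSum_nonneg (x : Fin (d + 1) → ℝ) : 0 ≤ posSum x :=
  Finset.sum_nonneg fun _ _ => le_max_right _ _

theorem negSum_eq_zero {y : Fin (d + 1) → ℝ} (h : negSum y = 0) (i : Fin (d + 1)) : 0 ≤ y i := by
  have := (Finset.sum_eq_zero_iff_of_nonneg fun i _ => le_max_right (-y i) 0).1 h i
    (Finset.mem_univ i)
  have h2 := le_max_left (-y i) 0
  linarith

theorem negSum_eq_zero_of_nonneg {y : Fin (d + 1) → ℝ} (h : ∀ i, 0 ≤ y i) : negSum y = 0 :=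
  Finset.sum_eq_zero fun i _ => max_eq_right (by linarith [h i])

theorem posSum_pos {y : Fin (d + 1) → ℝ} {i : Fin (d + 1)} (h : 0 < y i) : 0 < posSum y :=
  Finset.sum_pos' (fun _ _ => le_max_right _ _) ⟨i, Finset.mem_univ i, lt_max_of_lt_left h⟩

theorem posSum_eq_zero_of_nonpos {y : Fin (d + 1) → ℝ} (h : ∀ i, y i ≤ 0) : posSum y = 0 :=
  Finset.sum_eq_zero fun i _ => max_eq_right (h i)

theorem scale_nonneg {t : ℝ} (h0 : 0 ≤ t) (h1 : t ≤ 1) (x : Fin (d + 1) → ℝ) : 0 ≤ scale t x :=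
  add_nonneg (by linarith) (mul_nonneg h0 (negSum_nonneg _))

theorem push_nonneg {t : ℝ} (h0 : 0 ≤ t) (h1 : t ≤ 1) (x : Fin (d + 1) → ℝ) (i : Fin (d + 1)) :
    0 ≤ push t x i := by
  refine add_nonneg (mul_nonneg (scale_nonneg h0 h1 x) (mul_nonneg h0 (spread_nonneg x))) ?_
  split_ifs
  · exact mul_nonneg h0 (posSum_nonneg _)
  · exact le_rfl

/-- The definition exhibits a multiple of `x` plus a nonnegative push, which controls signs; this
form, in terms of the shifted vector, is the one that shows nonvanishing. -/
theorem flow_eq (t : ℝ) (x : Fin (d + 1) → ℝ) (i : Fin (d + 1)) :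
    flow t x i = scale t x * shifted t x i + if i = 0 then t * posSum (shifted t x) else 0 := by
  simp only [flow, push, shifted]
  ring

theorem spread_const (c : ℝ) : spread (fun _ : Fin (d + 1) => c) = 0 := by
  simp [spread]

theorem spread_of_nonneg {x : Fin (d + 1) → ℝ} (h : ∀ i, 0 ≤ x i) : spread x = 0 := by
  have : ∀ i, max (-x i) 0 = 0 := fun i => max_eq_right (by linarith [h i])
  simp [spread, this]

/-- Coordinate `i` has negative part zero, so the `(i, j)` term of the spread is already the
negative part of `x j`. Hence at time 1 the shift carries `x` into the nonnegative orthant. -/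
theorem neg_le_spread {x : Fin (d + 1) → ℝ} {i : Fin (d + 1)} (hi : 0 ≤ x i) (j : Fin (d + 1)) :
    -x j ≤ spread x := by
  have h1 : |max (-x i) 0 - max (-x j) 0| ≤ ∑ j, |max (-x i) 0 - max (-x j) 0| :=
    Finset.single_le_sum (f := fun j => |max (-x i) 0 - max (-x j) 0|)
      (fun _ _ => abs_nonneg _) (Finset.mem_univ j)
  have h2 : ∑ j, |max (-x i) 0 - max (-x j) 0| ≤ spread x :=
    Finset.single_le_sum (f := fun i => ∑ j, |max (-x i) 0 - max (-x j) 0|)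
      (fun _ _ => Finset.sum_nonneg fun _ _ => abs_nonneg _) (Finset.mem_univ i)
  have h3 : max (-x i) 0 = 0 := max_eq_right (by linarith)
  have h4 : max (-x j) 0 ≤ |max (-x i) 0 - max (-x j) 0| := by
    rw [h3, zero_sub, abs_neg]; exact le_abs_self _
  linarith [le_max_left (-x j) 0]

/-- A vector that a uniform translation takes to zero is constant; then its spread vanishes and
nothing was translated. -/
theorem shifted_ne_zero {t : ℝ} {x : Fin (d + 1) → ℝ} (hx : x ≠ 0) : shifted t x ≠ 0 := by
  intro h
  have h1 : x = fun _ => -(t * spread x) := by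
    ext i
    have := congrFun h i
    simp only [shifted, Pi.zero_apply] at this
    linarith
  have h2 : spread x = 0 := by
    rw [h1]; exact spread_const _
  apply hx
  rw [h1, h2]
  ext
  simp

theorem flow_ne_zero {t : ℝ} (h0 : 0 ≤ t) (h1 : t ≤ 1) {x : Fin (d + 1) → ℝ} (hx : x ≠ 0) :
    flow t x ≠ 0 := by
  intro h
  have hy := shifted_ne_zero (t := t) hx
  have hi : ∀ i, scale t x * shifted t x i
      + (if i = 0 then t * posSum (shifted t x) else 0) = 0 := fun i => by
    rw [← flow_eq, h]; rfl
  set y := shifted t x with hy_def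
  have hN := negSum_nonneg y
  have hsc : scale t x = 1 - t + t * negSum y := rfl
  -- A zero scale forces `t = 1` and `y` nonnegative, so the term `posSum y` survives. With a
  -- positive scale, `y` is supported on coordinate 0 with `y 0 ≤ 0`; then `posSum y = 0` and `y`
  -- vanishes.
  rcases (scale_nonneg h0 h1 x).eq_or_lt' with hs | hs
  · have htN := mul_nonneg h0 hN
    have ht : t = 1 := by linarith
    have hN0 : negSum y = 0 := by
      rw [hs, ht] at hsc; linarith
    have h00 := hi 0
    rw [hs, if_pos rfl, ht] at h00
    obtain ⟨i, hne⟩ := Function.ne_iff.1 hy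
    have := posSum_pos (lt_of_le_of_ne (negSum_eq_zero hN0 i) (Ne.symm hne))
    linarith
  · have hz : ∀ i, i ≠ 0 → y i = 0 := fun i hi0 => by
      have := hi i
      rw [if_neg hi0, add_zero] at this
      exact (mul_eq_zero.1 this).resolve_left hs.ne'
    have h00 := hi 0
    rw [if_pos rfl] at h00
    have hP := mul_nonneg h0 (posSum_nonneg y)
    have hy0 : y 0 ≤ 0 := by
      by_contra hc
      have := mul_pos hs (not_le.1 hc)
      linarith
    have hP0 : posSum y = 0 := posSum_eq_zero_of_nonpos fun i => by
      by_cases hi0 : i = 0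
      · rw [hi0]; exact hy0
      · exact (hz i hi0).le
    rw [hP0, mul_zero, add_zero] at h00
    apply hy
    ext i
    by_cases hi0 : i = 0
    · rw [hi0]; exact (mul_eq_zero.1 h00).resolve_left hs.ne'
    · exact hz i hi0

theorem flow_zero (x : Fin (d + 1) → ℝ) : flow 0 x = x := by
  ext i
  simp [flow, scale, push]

theorem scale_one_of_nonneg {x : Fin (d + 1) → ℝ} {i : Fin (d + 1)} (hi : 0 ≤ x i) :
    scale 1 x = 0 := by
  have : negSum (shifted 1 x) = 0 := negSum_eq_zero_of_nonneg fun j => by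
    have := neg_le_spread hi j
    simp only [shifted]
    linarith
  simp [scale, this]

theorem flow_one_of_nonneg {x : Fin (d + 1) → ℝ} (hx : x ≠ 0) {i : Fin (d + 1)} (hi : 0 ≤ x i) :
    ∃ c : ℝ, 0 < c ∧ flow 1 x = Pi.single 0 c := by
  have hf : flow 1 x = Pi.single 0 (posSum (shifted 1 x)) := by
    ext j
    rw [flow_eq, scale_one_of_nonneg hi, zero_mul, zero_add, one_mul, Pi.single_apply]
  refine ⟨_, lt_of_le_of_ne (posSum_nonneg _) fun h => ?_, hf⟩
  rw [← h, Pi.single_zero] at hf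
  exact flow_ne_zero zero_le_one le_rfl hx hf

theorem flow_single {t : ℝ} (h0 : 0 ≤ t) (h1 : t ≤ 1) {c : ℝ} (hc : 0 < c) :
    ∃ c' : ℝ, 0 < c' ∧ flow t (Pi.single (0 : Fin (d + 1)) c) = Pi.single 0 c' := by
  have hnn : ∀ i, 0 ≤ (Pi.single (0 : Fin (d + 1)) c : Fin (d + 1) → ℝ) i := fun i => by
    rw [Pi.single_apply]; split_ifs <;> linarith
  have hs := spread_of_nonneg hnn
  have hne : (Pi.single (0 : Fin (d + 1)) c : Fin (d + 1) → ℝ) ≠ 0 := by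
    rw [Ne, Pi.single_eq_zero_iff]; exact hc.ne'
  set x : Fin (d + 1) → ℝ := Pi.single (0 : Fin (d + 1)) c
  have hf : flow t x = Pi.single 0 (scale t x * c + t * posSum (shifted t x)) := by
    ext j
    rw [flow_eq, Pi.single_apply]
    by_cases hj : j = 0
    · subst hj
      simp [shifted, hs, x]
    · simp [shifted, hs, x, hj]
  refine ⟨_, lt_of_le_of_ne (add_nonneg (mul_nonneg (scale_nonneg h0 h1 x) hc.le)
    (mul_nonneg h0 (posSum_nonneg _))) fun h => ?_, hf⟩
  rw [← h, Pi.single_zero] at hf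
  exact flow_ne_zero h0 h1 hne hf

theorem continuous_spread : Continuous (spread (d := d)) := by
  unfold spread; fun_prop

theorem continuous_shifted :
    Continuous fun p : ℝ × (Fin (d + 1) → ℝ) => shifted p.1 p.2 := by
  have := continuous_spread (d := d)
  unfold shifted; fun_prop

theorem continuous_negSum : Continuous (negSum (d := d)) := by
  unfold negSum; fun_prop

theorem continuous_posSum : Continuous (posSum (d := d)) := by
  unfold posSum; fun_prop

theorem continuous_absSum : Continuous (absSum (d := d)) := by
  unfold absSum; fun_prop

theorem continuous_scale :
    Continuous fun p : ℝ × (Fin (d + 1) → ℝ) => scale p.1 p.2 := by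
  have h1 := continuous_negSum.comp (continuous_shifted (d := d))
  simp only [Function.comp_def] at h1
  unfold scale; fun_prop

theorem continuous_push (i : Fin (d + 1)) :
    Continuous fun p : ℝ × (Fin (d + 1) → ℝ) => push p.1 p.2 i := by
  have h1 := continuous_posSum.comp (continuous_shifted (d := d))
  have h2 := continuous_scale (d := d)
  have h3 := continuous_spread (d := d)
  simp only [Function.comp_def] at h1
  unfold push
  split_ifs <;> fun_prop

theorem continuous_flow :
    Continuous fun p : ℝ × (Fin (d + 1) → ℝ) => flow p.1 p.2 := by
  have h2 := continuous_scale (d := d)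
  have h3 := continuous_push (d := d)
  unfold flow; fun_prop

theorem absSum_pos {x : Fin (d + 1) → ℝ} (hx : x ≠ 0) : 0 < absSum x := by
  obtain ⟨i, hi⟩ := Function.ne_iff.1 hx
  exact Finset.sum_pos' (fun _ _ => abs_nonneg _) ⟨i, Finset.mem_univ i, abs_pos.2 hi⟩

theorem absSum_smul {c : ℝ} (hc : 0 ≤ c) (x : Fin (d + 1) → ℝ) : absSum (c • x) = c * absSum x := by
  simp [absSum, abs_mul, Finset.mul_sum, abs_of_nonneg hc]

/-! ### Passage between nonzero vectors and the unit sphere. -/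

/-- Nonzero vectors. -/
abbrev NonzeroVec (d : ℕ) : Type := {z : Fin (d + 1) → ℝ // z ≠ 0}

/-- The flow on nonzero vectors. -/
noncomputable def flowMap : C(unitInterval × NonzeroVec d, NonzeroVec d) where
  toFun p := ⟨flow p.1 p.2.1, flow_ne_zero p.1.2.1 p.1.2.2 p.2.2⟩
  continuous_toFun := by
    refine Continuous.subtype_mk ?_ _
    exact continuous_flow.comp (f := fun p : unitInterval × NonzeroVec d => ((p.1 : ℝ), p.2.1))
      (by fun_prop)

/-- Radial projection to the standard sphere. -/
noncomputable def toSphere : C(NonzeroVec d, StdSphere d) where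
  toFun z := ⟨‖WithLp.toLp 2 z.1‖⁻¹ • WithLp.toLp 2 z.1, by
    have h : WithLp.toLp 2 z.1 ≠ 0 := fun h => z.2 (by simpa using h)
    simp [norm_smul, inv_mul_cancel₀ (norm_ne_zero_iff.2 h)]⟩
  continuous_toFun := by
    refine Continuous.subtype_mk ?_ _
    have h1 : Continuous fun z : NonzeroVec d => WithLp.toLp 2 z.1 :=
      (PiLp.continuous_toLp 2 _).comp continuous_subtype_val
    refine Continuous.smul (h1.norm.inv₀ fun z => ?_) h1
    exact norm_ne_zero_iff.2 fun h => z.2 (by simpa using h)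

theorem toSphere_apply (z : NonzeroVec d) (i : Fin (d + 1)) :
    (toSphere z).1 i = ‖WithLp.toLp 2 z.1‖⁻¹ * z.1 i := rfl

theorem norm_toLp_pos (z : NonzeroVec d) : 0 < ‖WithLp.toLp 2 z.1‖ :=
  norm_pos_iff.2 fun h => z.2 (by simpa using h)

/-- The coordinates of a point of the standard sphere. -/
noncomputable def ofSphere : C(StdSphere d, NonzeroVec d) where
  toFun x := ⟨WithLp.ofLp x.1, fun h => by
    have h1 : x.1 = 0 := by simpa using h
    have h2 := x.2
    rw [h1] at h2
    simp at h2⟩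
  continuous_toFun :=
    Continuous.subtype_mk ((PiLp.continuous_ofLp 2 _).comp continuous_subtype_val) _

/-- Normalization of the sum of the absolute values of the coordinates to `1`. -/
noncomputable def absNormalize : C(NonzeroVec d, NonzeroVec d) where
  toFun z := ⟨(absSum z.1)⁻¹ • z.1, smul_ne_zero (inv_ne_zero (absSum_pos z.2).ne') z.2⟩
  continuous_toFun := by
    refine Continuous.subtype_mk ?_ _
    exact ((continuous_absSum.comp continuous_subtype_val).inv₀
      fun z => (absSum_pos z.2).ne').smul continuous_subtype_val

theorem toSphere_eq_of_smul {z z' : NonzeroVec d} {c : ℝ} (hc : 0 < c) (h : z'.1 = c • z.1) :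
    toSphere z' = toSphere z := by
  ext i
  rw [toSphere_apply, toSphere_apply, h, WithLp.toLp_smul, norm_smul, Real.norm_of_nonneg hc.le]
  simp only [Pi.smul_apply, smul_eq_mul]
  have := (norm_toLp_pos z).ne'
  field_simp

theorem toSphere_ofSphere (x : StdSphere d) : toSphere (ofSphere x) = x := by
  ext i
  rw [toSphere_apply]
  have : ‖WithLp.toLp 2 (ofSphere x).1‖ = 1 := by simp [ofSphere]
  rw [this]
  simp [ofSphere]

theorem toSphere_absNormalize (z : NonzeroVec d) : toSphere (absNormalize z) = toSphere z :=
  toSphere_eq_of_smul (inv_pos.2 (absSum_pos z.2)) rfl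

theorem toSphere_single {z : NonzeroVec d} {c : ℝ} (hc : 0 < c) (h : z.1 = Pi.single 0 c) :
    toSphere z = StdSphere.base d := by
  have hb : (ofSphere (StdSphere.base d)).1 = Pi.single 0 1 := by
    simp [ofSphere, StdSphere.base]
  rw [← toSphere_ofSphere (StdSphere.base d)]
  refine toSphere_eq_of_smul hc ?_
  rw [h, hb, ← Pi.single_smul]
  simp

/-- The flow on the standard sphere. -/
noncomputable def sphereFlow : C(unitInterval × StdSphere d, StdSphere d) where
  toFun p := toSphere (flowMap (p.1, absNormalize (ofSphere p.2)))
  continuous_toFun := by fun_prop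

theorem sphereFlow_zero (x : StdSphere d) : sphereFlow (0, x) = x := by
  have : flowMap (0, absNormalize (ofSphere x)) = absNormalize (ofSphere x) :=
    Subtype.ext (flow_zero _)
  change toSphere (flowMap (0, absNormalize (ofSphere x))) = x
  rw [this, toSphere_absNormalize, toSphere_ofSphere]

theorem sphereFlow_base (t : unitInterval) :
    sphereFlow (t, StdSphere.base d) = StdSphere.base d := by
  have hb : (ofSphere (StdSphere.base d)).1 = Pi.single 0 1 := by
    simp [ofSphere, StdSphere.base]
  have h1 : (absNormalize (ofSphere (StdSphere.base d))).1 =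
      Pi.single 0 ((absSum (ofSphere (StdSphere.base d)).1)⁻¹) := by
    change (absSum (ofSphere (StdSphere.base d)).1)⁻¹ • (ofSphere (StdSphere.base d)).1 = _
    generalize (absSum (ofSphere (StdSphere.base d)).1)⁻¹ = a
    rw [hb, ← Pi.single_smul]
    simp
  obtain ⟨c, hc, hf⟩ := flow_single (d := d) t.2.1 t.2.2
    (inv_pos.2 (absSum_pos (ofSphere (StdSphere.base d)).2))
  rw [← h1] at hf
  exact toSphere_single hc hf

end OrthantFlow

/-! ## Complete multipartite complexes -/

namespace Multipartite

open OrthantFlow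

variable {V : Type*} [Fintype V] {d : ℕ}

/-- The points in barycentric coordinates whose support meets every fibre of `β` at most once. -/
def points (β : V → Fin (d + 1)) : Set (V → ℝ) :=
  {w | (∀ v, 0 ≤ w v) ∧ (∀ u v, w u ≠ 0 → w v ≠ 0 → β u = β v → u = v) ∧ ∑ v, w v = 1}

/-- The face carrying a point can be shrunk to its support, so membership becomes a condition on `w`
alone. -/
theorem realization_eq_points {β : V → Fin (d + 1)} {X : AbstractSimplicialComplex V}
    (hX : ∀ s, s ∈ X.faces ↔ s.Nonempty ∧ Set.InjOn β (s : Set V)) :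
    X.realization = points β := by
  classical
  ext w
  constructor
  · rintro ⟨h0, s, hs, hsupp, hsum⟩
    have hmem : ∀ v, w v ≠ 0 → v ∈ s := fun v hv => by
      by_contra h
      exact hv (hsupp v h)
    refine ⟨h0, fun u v hu hv h => ((hX s).1 hs).2 (hmem u hu) (hmem v hv) h, ?_⟩
    rw [← hsum]
    exact (Finset.sum_subset (Finset.subset_univ s) fun v _ hv => hsupp v hv).symm
  · rintro ⟨h0, hinj, hsum⟩
    have hs : ∑ v with w v ≠ 0, w v = 1 := by
      rw [Finset.sum_filter_ne_zero, hsum]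
    refine ⟨h0, Finset.univ.filter fun v => w v ≠ 0, (hX _).2 ⟨?_, ?_⟩, ?_, hs⟩
    · by_contra h
      rw [Finset.not_nonempty_iff_eq_empty] at h
      rw [h] at hs
      simp at hs
    · intro u hu v hv h
      exact hinj u v (by simpa using hu) (by simpa using hv) h
    · intro v hv
      by_contra h
      exact hv (by simpa using h)

/-- The signed coordinates of a point: vertices `e i` count positively, all others negatively. -/
noncomputable def coord (β : V → Fin (d + 1)) (e : Fin (d + 1) → V) (w : V → ℝ) :
    Fin (d + 1) → ℝ := fun i =>
  2 * w (e i) - ∑ v, if β v = i then w v else 0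

variable {β : V → Fin (d + 1)} {e f : Fin (d + 1) → V}

theorem continuous_coord : Continuous (coord β e) := by
  have : ∀ i, Continuous fun w : V → ℝ => ∑ v, if β v = i then w v else 0 := fun i => by
    refine continuous_finsetSum _ fun v _ => ?_
    split_ifs <;> fun_prop
  unfold coord
  fun_prop

section

variable [DecidableEq V]

/-- The point in the cross-polytope spanned by the vertices `e i` and `f i` with signed coordinates
proportional to `z`. -/
noncomputable def crossPoint (β : V → Fin (d + 1)) (e f : Fin (d + 1) → V) (z : Fin (d + 1) → ℝ) :
    V → ℝ := fun v =>
  ((if v = e (β v) then max (z (β v)) 0 else 0) +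
    (if v = f (β v) then max (-z (β v)) 0 else 0)) / absSum z

theorem sum_section (hf : ∀ i, β (f i) = i) (h : Fin (d + 1) → ℝ) :
    ∑ v, (if v = f (β v) then h (β v) else 0) = ∑ i, h i := by
  have h1 : ∀ v, (if v = f (β v) then h (β v) else 0) = ∑ i, if v = f i then h i else 0 := by
    intro v
    rw [Finset.sum_eq_single (β v)]
    · intro i _ hi
      rw [if_neg]
      rintro rfl
      exact hi (hf i).symm
    · simp
  simp_rw [h1]
  rw [Finset.sum_comm]
  simp

theorem max_add_max_neg (a : ℝ) : max a 0 + max (-a) 0 = |a| := by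
  rcases le_total 0 a with h | h
  · rw [max_eq_left h, max_eq_right (by linarith), abs_of_nonneg h, add_zero]
  · rw [max_eq_right h, max_eq_left (by linarith), abs_of_nonpos h, zero_add]

theorem crossPoint_mem_points (he : ∀ i, β (e i) = i) (hf : ∀ i, β (f i) = i)
    {z : Fin (d + 1) → ℝ} (hz : z ≠ 0) : crossPoint β e f z ∈ points β := by
  have ha := absSum_pos hz
  refine ⟨fun v => ?_, fun u v hu hv huv => ?_, ?_⟩
  · refine div_nonneg (add_nonneg ?_ ?_) ha.le <;> split_ifs <;> simp
  · have key : ∀ v, crossPoint β e f z v ≠ 0 →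
        (v = e (β v) ∧ 0 ≤ z (β v)) ∨ (v = f (β v) ∧ z (β v) < 0) := by
      intro v hv
      by_contra hc
      push Not at hc
      apply hv
      unfold crossPoint
      rw [div_eq_zero_iff]
      left
      have h1 : (if v = e (β v) then max (z (β v)) 0 else 0) = 0 := by
        split_ifs with h
        · exact max_eq_right (hc.1 h).le
        · rfl
      have h2 : (if v = f (β v) then max (-z (β v)) 0 else 0) = 0 := by
        split_ifs with h
        · exact max_eq_right (by linarith [hc.2 h])
        · rfl
      rw [h1, h2, add_zero]
    rcases key u hu with ⟨h1, h2⟩ | ⟨h1, h2⟩ <;> rcases key v hv with ⟨h3, h4⟩ | ⟨h3, h4⟩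
    · rw [h1, h3, huv]
    · rw [huv] at h2; linarith
    · rw [huv] at h2; linarith
    · rw [h1, h3, huv]
  · unfold crossPoint
    rw [← Finset.sum_div, Finset.sum_add_distrib, sum_section he fun i => max (z i) 0,
      sum_section hf fun i => max (-z i) 0, ← Finset.sum_add_distrib]
    simp_rw [max_add_max_neg]
    exact div_self ha.ne'

/-- If `f i = e i`, both signed parts of `z i` land on one vertex and the sign is lost; `hfe`
excludes this. The case must be allowed because a block may consist of `e i` alone. -/
theorem coord_crossPoint (he : ∀ i, β (e i) = i) (hf : ∀ i, β (f i) = i)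
    {z : Fin (d + 1) → ℝ} (hfe : ∀ i, f i = e i → 0 ≤ z i) :
    coord β e (crossPoint β e f z) = (absSum z)⁻¹ • z := by
  ext i
  have h1 : crossPoint β e f z (e i) = max (z i) 0 / absSum z := by
    unfold crossPoint
    rw [he, if_pos rfl]
    split_ifs with h
    · rw [max_eq_right (by linarith [hfe i h.symm] : -z i ≤ 0), add_zero]
    · rw [add_zero]
  have h2 : ∑ v, (if β v = i then crossPoint β e f z v else 0) = |z i| / absSum z := by
    have : ∀ v, (if β v = i then crossPoint β e f z v else 0) =
        ((if v = e (β v) then (if β v = i then max (z (β v)) 0 else 0) else 0) +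
        (if v = f (β v) then (if β v = i then max (-z (β v)) 0 else 0) else 0)) / absSum z := by
      intro v
      unfold crossPoint
      split_ifs <;> simp
    simp_rw [this]
    rw [← Finset.sum_div, Finset.sum_add_distrib,
      sum_section he fun j => if j = i then max (z j) 0 else 0,
      sum_section hf fun j => if j = i then max (-z j) 0 else 0]
    simp
  unfold coord
  rw [h1, h2, ← max_add_max_neg]
  have h3 : max (z i) 0 - max (-z i) 0 = z i := by
    rcases le_total 0 (z i) with h | h
    · rw [max_eq_left h, max_eq_right (by linarith)]; ring
    · rw [max_eq_right h, max_eq_left (by linarith)]; ring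
  simp only [Pi.smul_apply, smul_eq_mul]
  linear_combination (absSum z)⁻¹ * h3

/-- At most one vertex of block `i` carries weight. If it is not `e i`, it serves as `u`; otherwise
`u = e i`, which needs no second vertex in the block. -/
theorem coord_cases (he : ∀ i, β (e i) = i) {w : V → ℝ} (hw : w ∈ points β) (i : Fin (d + 1)) :
    ∃ u, β u = i ∧ (u = e i → 0 ≤ coord β e w i) ∧ ∀ v, β v = i →
      w v = (if v = e i then max (coord β e w i) 0 else 0) +
        (if v = u then max (-coord β e w i) 0 else 0) := by
  obtain ⟨h0, hinj, -⟩ := hw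
  by_cases h : ∃ u, β u = i ∧ u ≠ e i ∧ w u ≠ 0
  · obtain ⟨u, hu, hue, hwu⟩ := h
    have hz : ∀ v, β v = i → v ≠ u → w v = 0 := fun v hv hvu => by
      by_contra hc
      exact hvu (hinj v u hc hwu (by rw [hv, hu]))
    have hc : coord β e w i = -w u := by
      unfold coord
      rw [hz (e i) (he i) hue.symm, Finset.sum_eq_single u]
      · simp [hu]
      · intro v _ hv
        split_ifs with h
        · exact hz v h hv
        · rfl
      · simp
    refine ⟨u, hu, fun h => absurd h hue, fun v hv => ?_⟩
    rw [hc, neg_neg, max_eq_left (h0 u), max_eq_right (by linarith [h0 u])]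
    by_cases hvu : v = u
    · simp [hvu]
    · simp [hvu, hz v hv hvu]
  · push Not at h
    have hc : coord β e w i = w (e i) := by
      unfold coord
      rw [Finset.sum_eq_single (e i)]
      · simp [he]; ring
      · intro v _ hv
        split_ifs with h'
        · exact h v h' hv
        · rfl
      · simp
    refine ⟨e i, he i, fun _ => hc ▸ h0 _, fun v hv => ?_⟩
    rw [hc, max_eq_left (h0 _), max_eq_right (by linarith [h0 (e i)])]
    by_cases hve : v = e i
    · simp [hve]
    · simp [hve, h v hv hve]

theorem absSum_coord (he : ∀ i, β (e i) = i) {w : V → ℝ} (hw : w ∈ points β) :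
    absSum (coord β e w) = 1 := by
  choose f hf _ hw' using coord_cases he hw
  have : ∀ v, w v = (if v = e (β v) then max (coord β e w (β v)) 0 else 0) +
        (if v = f (β v) then max (-coord β e w (β v)) 0 else 0) := fun v => hw' _ v rfl
  have hs := hw.2.2
  rw [Finset.sum_congr rfl fun v _ => this v, Finset.sum_add_distrib,
    sum_section he fun i => max (coord β e w i) 0,
    sum_section hf fun i => max (-coord β e w i) 0, ← Finset.sum_add_distrib] at hs
  simp only [max_add_max_neg] at hs
  exact hs

theorem exists_eq_crossPoint (he : ∀ i, β (e i) = i) {w : V → ℝ} (hw : w ∈ points β) :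
    ∃ f : Fin (d + 1) → V, (∀ i, β (f i) = i) ∧ (∀ i, f i = e i → 0 ≤ coord β e w i) ∧
      w = crossPoint β e f (coord β e w) := by
  choose f hf hfe hw' using coord_cases he hw
  refine ⟨f, hf, hfe, ?_⟩
  ext v
  rw [crossPoint, absSum_coord he hw, div_one]
  exact hw' _ v rfl

theorem coord_ne_zero (he : ∀ i, β (e i) = i) {w : V → ℝ} (hw : w ∈ points β) :
    coord β e w ≠ 0 := by
  intro h
  have := absSum_coord he hw
  rw [h] at this
  simp [absSum] at this

/-- The signed coordinates, as a nonzero vector. -/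
noncomputable def coordMap (he : ∀ i, β (e i) = i) : C(points β, NonzeroVec d) where
  toFun w := ⟨coord β e w.1, coord_ne_zero he w.2⟩
  continuous_toFun := (continuous_coord.comp continuous_subtype_val).subtype_mk _

/-- The inclusion of a cross-polytope. -/
noncomputable def crossMap (he : ∀ i, β (e i) = i) (hf : ∀ i, β (f i) = i) :
    C(NonzeroVec d, points β) where
  toFun z := ⟨crossPoint β e f z.1, crossPoint_mem_points he hf z.2⟩
  continuous_toFun := by
    refine Continuous.subtype_mk (continuous_pi fun v => ?_) _
    have hv : Continuous fun z : NonzeroVec d => z.1 (β v) :=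
      (continuous_apply _).comp continuous_subtype_val
    unfold crossPoint
    refine Continuous.div ?_ (continuous_absSum.comp continuous_subtype_val)
      fun z => (absSum_pos z.2).ne'
    have h1 : Continuous fun z : NonzeroVec d => max (z.1 (β v)) 0 := hv.max continuous_const
    have h2 : Continuous fun z : NonzeroVec d => max (-z.1 (β v)) 0 := hv.neg.max continuous_const
    refine Continuous.add ?_ ?_ <;> split_ifs <;> first | assumption | exact continuous_const

/-- The flow on the points of a multipartite complex, in barycentric coordinates. -/
noncomputable def pointFlow (β : V → Fin (d + 1)) (e : Fin (d + 1) → V) (t : ℝ) (w : V → ℝ) :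
    V → ℝ := fun v =>
  (if v = e (β v) then max (flow t (coord β e w) (β v)) 0
    else max (scale t (coord β e w) * w v - push t (coord β e w) (β v)) 0) /
    absSum (flow t (coord β e w))

/-- Weight may cross from `f i` to `e i`, but never has to leave `e i` for another vertex of the
block, which the coordinates would not determine. -/
theorem flow_nonneg {t : ℝ} (h0 : 0 ≤ t) (h1 : t ≤ 1) {x : Fin (d + 1) → ℝ} {i : Fin (d + 1)}
    (hi : 0 ≤ x i) : 0 ≤ flow t x i :=
  add_nonneg (mul_nonneg (scale_nonneg h0 h1 x) hi) (push_nonneg h0 h1 x i)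

/-- The formula for `pointFlow` does not involve `f`, so it is visibly continuous on all of `points
β`. On each cross-polytope it is nevertheless the flow of the coordinates: as the push is
nonnegative, truncation at 0 keeps weightless vertices other than `e i` weightless. -/
theorem pointFlow_eq {t : ℝ} (h0 : 0 ≤ t) (h1 : t ≤ 1) (he : ∀ i, β (e i) = i) {w : V → ℝ}
    (hw : w ∈ points β) (hfe : ∀ i, f i = e i → 0 ≤ coord β e w i)
    (hwf : w = crossPoint β e f (coord β e w)) :
    pointFlow β e t w = crossPoint β e f (flow t (coord β e w)) := by
  ext v
  have hv := congrFun hwf v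
  rw [crossPoint, absSum_coord he hw, div_one] at hv
  unfold pointFlow crossPoint
  congr 1
  set x := coord β e w
  have hs := scale_nonneg h0 h1 x
  have hp := push_nonneg h0 h1 x (β v)
  by_cases hve : v = e (β v)
  · rw [if_pos hve, if_pos hve]
    split_ifs with hvf
    · have := flow_nonneg h0 h1 (hfe (β v) (hvf.symm.trans hve))
      rw [max_eq_right (by linarith : -flow t x (β v) ≤ 0), add_zero]
    · rw [add_zero]
  · rw [if_neg hve, zero_add] at hv
    rw [if_neg hve, if_neg hve, zero_add, hv]
    split_ifs with hvf
    · rcases le_total 0 (x (β v)) with h | h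
      · have := flow_nonneg h0 h1 h
        rw [max_eq_right (by linarith : -x (β v) ≤ 0),
          max_eq_right (by linarith : -flow t x (β v) ≤ 0), mul_zero, max_eq_right (by linarith)]
      · rw [max_eq_left (by linarith : 0 ≤ -x (β v))]
        congr 1
        unfold flow
        ring
    · rw [mul_zero, max_eq_right (by linarith)]

theorem pointFlow_mem {t : ℝ} (h0 : 0 ≤ t) (h1 : t ≤ 1) (he : ∀ i, β (e i) = i) {w : V → ℝ}
    (hw : w ∈ points β) : pointFlow β e t w ∈ points β := by
  obtain ⟨f, hf, hfe, hwf⟩ := exists_eq_crossPoint he hw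
  rw [pointFlow_eq h0 h1 he hw hfe hwf]
  exact crossPoint_mem_points he hf (flow_ne_zero h0 h1 (coord_ne_zero he hw))

/-- The flow on the points of a multipartite complex. -/
noncomputable def pointFlowMap (he : ∀ i, β (e i) = i) :
    C(unitInterval × points β, points β) where
  toFun p := ⟨pointFlow β e p.1 p.2.1, pointFlow_mem p.1.2.1 p.1.2.2 he p.2.2⟩
  continuous_toFun := by
    refine Continuous.subtype_mk (continuous_pi fun v => ?_) _
    have hc : Continuous fun p : unitInterval × points β => ((p.1 : ℝ), coord β e p.2.1) :=
      (continuous_subtype_val.comp continuous_fst).prodMk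
        (continuous_coord.comp (continuous_subtype_val.comp continuous_snd))
    have hv : Continuous fun p : unitInterval × points β => p.2.1 v :=
      (continuous_apply v).comp (continuous_subtype_val.comp continuous_snd)
    have h1 := continuous_flow.comp hc
    have h2 := continuous_scale.comp hc
    have h3 := (continuous_push (β v)).comp hc
    have h4 := continuous_absSum.comp h1
    simp only [Function.comp_def] at h1 h2 h3 h4
    unfold pointFlow
    refine Continuous.div ?_ h4 fun p =>
      (absSum_pos (flow_ne_zero p.1.2.1 p.1.2.2 (coord_ne_zero he p.2.2))).ne'
    split_ifs <;> fun_prop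

theorem pointFlowMap_zero (he : ∀ i, β (e i) = i) (w : points β) :
    pointFlowMap he (0, w) = w := by
  obtain ⟨f, hf, hfe, hwf⟩ := exists_eq_crossPoint he w.2
  refine Subtype.ext ?_
  change pointFlow β e 0 w.1 = w.1
  rw [pointFlow_eq le_rfl zero_le_one he w.2 hfe hwf, flow_zero, ← hwf]

end

end Multipartite

/-! ### The wedge of spheres and the collapse onto it. -/

namespace Multipartite

open OrthantFlow

variable {V : Type*} [DecidableEq V] {d N : ℕ} {β : V → Fin (d + 1)}
  {e : Fin (d + 1) → V}

theorem crossPoint_single (he : ∀ i, β (e i) = i) (f : Fin (d + 1) → V) {c : ℝ} (hc : 0 < c) :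
    crossPoint β e f (Pi.single 0 c) = Pi.single (e 0) 1 := by
  have ha : absSum (Pi.single (0 : Fin (d + 1)) c) = c := by
    unfold absSum
    rw [Finset.sum_eq_single 0]
    · simp [abs_of_pos hc]
    · intro i _ hi
      simp [hi]
    · simp
  have hn : ∀ i : Fin (d + 1), max (-(Pi.single (0 : Fin (d + 1)) c : Fin (d + 1) → ℝ) i) 0 = 0 := by
    intro i
    by_cases hi : i = 0
    · subst hi; simp [hc.le]
    · simp [hi]
  ext v
  unfold crossPoint
  rw [ha, hn, ite_self, add_zero]
  by_cases hv : v = e 0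
  · subst hv
    simp [he, hc.le, hc.ne']
  · rw [Pi.single_eq_of_ne hv]
    by_cases h0 : β v = 0
    · rw [h0, if_neg hv, zero_div]
    · simp [h0]

theorem crossPoint_smul (f : Fin (d + 1) → V) {c : ℝ} (hc : 0 < c) (z : Fin (d + 1) → ℝ) :
    crossPoint β e f (c • z) = crossPoint β e f z := by
  have h1 : ∀ a : ℝ, max (c * a) 0 = c * max a 0 := fun a => by
    rw [mul_max_of_nonneg _ _ hc.le, mul_zero]
  ext v
  unfold crossPoint
  rw [absSum_smul hc.le]
  conv_rhs => rw [← mul_div_mul_left _ _ hc.ne']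
  simp only [Pi.smul_apply, smul_eq_mul, ← mul_neg, h1, mul_add, mul_ite, mul_zero]

theorem crossPoint_toSphere (f : Fin (d + 1) → V) (z : NonzeroVec d) :
    crossPoint β e f (ofSphere (toSphere z)).1 = crossPoint β e f z.1 :=
  crossPoint_smul f (inv_pos.2 (norm_toLp_pos z)) z.1

/-- The common base point of a wedge of spheres. -/
def wedgeBase (N d : ℕ) : WedgeOfSpheres N d := Quot.mk _ (Sum.inl ())

/-- The inclusion of a sphere into the wedge. -/
def wedgeIncl (k : Fin N) (x : StdSphere d) : WedgeOfSpheres N d := Quot.mk _ (Sum.inr ⟨k, x⟩)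

theorem wedgeIncl_base (k : Fin N) : wedgeIncl k (StdSphere.base d) = wedgeBase N d :=
  Quot.sound (WedgeRel.glue k)

theorem continuous_wedgeIncl (k : Fin N) : Continuous (wedgeIncl (d := d) k) :=
  continuous_quot_mk.comp (continuous_inr.comp continuous_sigmaMk)

/-- The continuous map on a wedge of spheres given by maps on the spheres that agree on the base
points. -/
def wedgeLift {Y : Type*} [TopologicalSpace Y] (y : Y) (g : Fin N → C(StdSphere d, Y))
    (h : ∀ k, g k (StdSphere.base d) = y) : C(WedgeOfSpheres N d, Y) where
  toFun := Quot.lift (Sum.elim (fun _ => y) fun p => g p.1 p.2) (by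
    rintro _ _ ⟨k⟩
    exact h k)
  continuous_toFun := continuous_quot_lift _
    (continuous_const.sumElim (continuous_sigma fun k => (g k).continuous))

theorem wedge_cases {P : WedgeOfSpheres N d → Prop} (h0 : P (wedgeBase N d))
    (h1 : ∀ k x, P (wedgeIncl k x)) (q : WedgeOfSpheres N d) : P q := by
  induction q using Quot.ind with
  | mk a => rcases a with ⟨⟩ | ⟨k, x⟩
            · exact h0
            · exact h1 k x

/-- The flow fixes the base point at all times, so it descends to the wedge. The homotopy is built
in curried form, as a map from the wedge to a space of paths, so that only maps out of the quotient
itself have to be constructed. -/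
theorem wedge_homotopic_id (g : C(WedgeOfSpheres N d, WedgeOfSpheres N d))
    (hb : g (wedgeBase N d) = wedgeBase N d)
    (hg : ∀ k x, g (wedgeIncl k x) = wedgeIncl k (sphereFlow (1, x))) :
    g.Homotopic (ContinuousMap.id _) := by
  let F : C(WedgeOfSpheres N d, C(unitInterval, WedgeOfSpheres N d)) :=
    wedgeLift (ContinuousMap.const _ (wedgeBase N d))
      (fun k => ContinuousMap.curry ⟨fun p : StdSphere d × unitInterval =>
        wedgeIncl k (sphereFlow (p.2, p.1)), (continuous_wedgeIncl k).comp (by fun_prop)⟩)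
      (fun k => by
        ext t
        change wedgeIncl k (sphereFlow (t, StdSphere.base d)) = wedgeBase N d
        rw [sphereFlow_base, wedgeIncl_base])
  refine ContinuousMap.Homotopic.symm ⟨⟨⟨fun p => F p.2 p.1, ?_⟩, ?_, ?_⟩⟩
  · exact (ContinuousMap.continuous_uncurry_of_continuous F).comp continuous_swap
  · refine wedge_cases rfl fun k x => ?_
    change wedgeIncl k (sphereFlow (0, x)) = wedgeIncl k x
    rw [sphereFlow_zero]
  · refine wedge_cases hb.symm fun k x => ?_
    exact (hg k x).symm

section Collapse

variable [Fintype V] (he : ∀ i, β (e i) = i) {φ : Fin N → Fin (d + 1) → V} (hφ : ∀ k i, β (φ k i) = i)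
  (hne : ∀ k i, φ k i ≠ e i)

/-- The map of the wedge onto the union of the cross-polytopes. -/
noncomputable def glue : C(WedgeOfSpheres N d, points β) :=
  wedgeLift ⟨Pi.single (e 0) 1, by
      rw [← crossPoint_single he e one_pos]
      exact crossPoint_mem_points he he (by simp)⟩
    (fun k => (crossMap he (hφ k)).comp ofSphere) (fun k => by
      refine Subtype.ext ?_
      change crossPoint β e (φ k) (ofSphere (StdSphere.base d)).1 = Pi.single (e 0) 1
      rw [← crossPoint_single he (φ k) one_pos]
      simp [ofSphere, StdSphere.base])

open Classical in
/-- The collapse of all faces but those spanned by the vertices `φ k i` for some `k`. -/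
noncomputable def collapseFun (φ : Fin N → Fin (d + 1) → V) (w : points β) :
    WedgeOfSpheres N d :=
  if h : ∃ k, ∀ i, w.1 (φ k i) ≠ 0 then
    wedgeIncl h.choose (toSphere (flowMap (1, coordMap he w)))
  else wedgeBase N d

include he hφ hne in
theorem coord_neg {w : points β} {k : Fin N} (h : ∀ i, w.1 (φ k i) ≠ 0) (i : Fin (d + 1)) :
    coord β e w.1 i < 0 := by
  obtain ⟨f, hf, hfe, hwf⟩ := exists_eq_crossPoint he w.2
  have h1 := h i
  rw [hwf, crossPoint, hφ, if_neg (hne k i), zero_add] at h1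
  by_contra hc
  apply h1
  rw [max_eq_right (by linarith), ite_self, zero_div]

theorem toSphere_flow_one {w : points β} {i : Fin (d + 1)} (h : 0 ≤ coord β e w.1 i) :
    toSphere (flowMap (1, coordMap he w)) = StdSphere.base d := by
  obtain ⟨c, hc, hf⟩ := flow_one_of_nonneg (coord_ne_zero he w.2) h
  exact toSphere_single hc hf

include he hφ hne in
theorem collapseFun_of_nonneg {w : points β} {i : Fin (d + 1)} (h : 0 ≤ coord β e w.1 i) :
    collapseFun he φ w = wedgeBase N d := by
  refine dif_neg ?_
  rintro ⟨k, hk⟩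
  exact absurd h (not_le.2 (coord_neg he hφ hne hk i))

include he hφ hne in
-- The formula holds on the whole closed cross-polytope: where some coordinate is nonnegative, the
-- time-1 flow already gives the base point.
theorem collapseFun_of_eq (hinj : Function.Injective φ) {w : points β} {k : Fin N}
    (h : w.1 = crossPoint β e (φ k) (coord β e w.1)) :
    collapseFun he φ w = wedgeIncl k (toSphere (flowMap (1, coordMap he w))) := by
  by_cases hA : ∃ i, 0 ≤ coord β e w.1 i
  · obtain ⟨i, hi⟩ := hA
    rw [collapseFun_of_nonneg he hφ hne hi, toSphere_flow_one he hi, wedgeIncl_base]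
  · push Not at hA
    have hk : ∀ i, w.1 (φ k i) ≠ 0 := fun i => by
      rw [h, crossPoint, absSum_coord he w.2, hφ, if_neg (hne k i), if_pos rfl, zero_add, div_one]
      exact (lt_max_of_lt_left (by linarith [hA i])).ne'
    have hex : ∃ k, ∀ i, w.1 (φ k i) ≠ 0 := ⟨k, hk⟩
    -- The support meets each block only once, so it determines the vertices `φ k i`, and these
    -- determine `k`.
    have hch : hex.choose = k := hinj (funext fun i =>
      w.2.2.1 _ _ (hex.choose_spec i) (hk i) (by rw [hφ, hφ]))
    rw [collapseFun, dif_pos hex, hch]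

include he in
theorem exists_of_coord_neg (hsurj : ∀ f : Fin (d + 1) → V, (∀ i, β (f i) = i) →
      (∀ i, f i ≠ e i) → ∃ k, φ k = f) {w : points β} (h : ∀ i, coord β e w.1 i < 0) :
    ∃ k, w.1 = crossPoint β e (φ k) (coord β e w.1) := by
  obtain ⟨f, hf, hfe, hwf⟩ := exists_eq_crossPoint he w.2
  obtain ⟨k, rfl⟩ := hsurj f hf fun i hi => absurd (hfe i hi) (not_le.2 (h i))
  exact ⟨k, hwf⟩

include he hφ hne in
-- Finitely many closed sets cover the space: those where a given coordinate is nonnegative, with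
-- constant value the base point, and the cross-polytopes, where the map is given by the flow.
theorem continuous_collapseFun (hinj : Function.Injective φ)
    (hsurj : ∀ f : Fin (d + 1) → V, (∀ i, β (f i) = i) → (∀ i, f i ≠ e i) → ∃ k, φ k = f) :
    Continuous (collapseFun he φ) := by
  have hcc : Continuous fun w : points β => coord β e w.1 :=
    continuous_coord.comp continuous_subtype_val
  refine (locallyFinite_of_finite (Sum.elim (fun i => {w : points β | 0 ≤ coord β e w.1 i})
    fun k => {w : points β | w = crossMap he (hφ k) (coordMap he w)})).continuous ?_ ?_ ?_
  · refine Set.eq_univ_of_forall fun w => Set.mem_iUnion.2 ?_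
    by_cases hA : ∃ i, 0 ≤ coord β e w.1 i
    · obtain ⟨i, hi⟩ := hA
      exact ⟨Sum.inl i, hi⟩
    · push Not at hA
      obtain ⟨k, hk⟩ := exists_of_coord_neg he hsurj hA
      exact ⟨Sum.inr k, Subtype.ext hk⟩
  · rintro (i | k)
    · exact isClosed_le continuous_const ((continuous_apply i).comp hcc)
    · exact isClosed_eq continuous_id (by fun_prop)
  · rintro (i | k)
    · exact continuousOn_const.congr fun w hw => collapseFun_of_nonneg he hφ hne hw
    · refine ContinuousOn.congr (f := fun w => wedgeIncl k (toSphere (flowMap (1, coordMap he w))))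
        ?_ fun w hw => collapseFun_of_eq he hφ hne hinj (congrArg Subtype.val hw)
      exact ((continuous_wedgeIncl k).comp (by fun_prop)).continuousOn

include he hφ hne in
/-- The points of a complete multipartite complex form a space homotopy equivalent to a wedge of
spheres, one for each choice of a vertex other than `e i` in every block. -/
theorem nonempty_points_homotopyEquiv (hinj : Function.Injective φ)
    (hsurj : ∀ f : Fin (d + 1) → V, (∀ i, β (f i) = i) → (∀ i, f i ≠ e i) → ∃ k, φ k = f) :
    Nonempty (ContinuousMap.HomotopyEquiv (points β) (WedgeOfSpheres N d)) := by
  let c : C(points β, WedgeOfSpheres N d) :=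
    ⟨collapseFun he φ, continuous_collapseFun he hφ hne hinj hsurj⟩
  refine ⟨⟨c, glue he hφ, ?_, ?_⟩⟩
  -- The homotopy is `pointFlowMap`; what remains is that its time-1 map equals `glue` after
  -- `collapseFun`.
  · refine ContinuousMap.Homotopic.symm ⟨⟨pointFlowMap he, pointFlowMap_zero he, fun w => ?_⟩⟩
    refine Subtype.ext ?_
    change pointFlow β e 1 w.1 = (glue he hφ (collapseFun he φ w)).1
    by_cases hA : ∃ i, 0 ≤ coord β e w.1 i
    · obtain ⟨i, hi⟩ := hA
      obtain ⟨f, hf, hfe, hwf⟩ := exists_eq_crossPoint he w.2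
      obtain ⟨a, ha, hflow⟩ := flow_one_of_nonneg (coord_ne_zero he w.2) hi
      rw [collapseFun_of_nonneg he hφ hne hi, pointFlow_eq zero_le_one le_rfl he w.2 hfe hwf,
        hflow, crossPoint_single he f ha]
      rfl
    · push Not at hA
      obtain ⟨k, hk⟩ := exists_of_coord_neg he hsurj hA
      rw [collapseFun_of_eq he hφ hne hinj hk, pointFlow_eq zero_le_one le_rfl he w.2
        (fun i h => absurd h (hne k i)) hk]
      exact (crossPoint_toSphere (φ k) (flowMap (1, coordMap he w))).symm
  · refine wedge_homotopic_id _ ?_ fun k x => ?_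
    · change collapseFun he φ ⟨Pi.single (e 0) 1, _⟩ = _
      refine collapseFun_of_nonneg he hφ hne (i := 0) ?_
      change 0 ≤ coord β e (Pi.single (e 0) 1) 0
      rw [← crossPoint_single he e one_pos, coord_crossPoint he he (by
        intro i _; rw [Pi.single_apply]; split_ifs <;> norm_num)]
      simp [absSum, Finset.sum_nonneg]
    · change collapseFun he φ (crossMap he (hφ k) (ofSphere x)) = _
      -- `flow` is not homogeneous, so the normalization matters: it is exactly the one built into
      -- `sphereFlow`, which makes the final comparison definitional.
      have hco : coordMap he (crossMap he (hφ k) (ofSphere x)) = absNormalize (ofSphere x) :=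
        Subtype.ext (coord_crossPoint he (hφ k) fun i h => absurd h (hne k i))
      rw [collapseFun_of_eq he hφ hne hinj, hco]
      · rfl
      · change crossPoint β e (φ k) (ofSphere x).1 = crossPoint β e (φ k)
          (coordMap he (crossMap he (hφ k) (ofSphere x))).1
        rw [hco]
        exact (crossPoint_smul (φ k) (inv_pos.2 (absSum_pos (ofSphere x).2)) _).symm

end Collapse

end Multipartite

/-! ## Non-commuting sets -/

section NonCommuting

variable {G : Type*} [Group G]

/-- Joins are defined by "empty or a face" on each part; for `NC` this disjunction is just pairwise
non-commutation. -/
theorem NC_eq_empty_or_mem_faces (s : Finset {g : G // g ≠ 1}) :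
    (s = ∅ ∨ s ∈ (NC G).faces) ↔
      (s : Set {g : G // g ≠ 1}).Pairwise fun a b => ¬ Commute a.1 b.1 := by
  have h : IsNonCommuting (s.map (Function.Embedding.subtype _)) ↔
      (s : Set {g : G // g ≠ 1}).Pairwise fun a b => ¬ Commute a.1 b.1 := by
    rw [IsNonCommuting, Finset.coe_map]
    exact Set.InjOn.pairwise_image Subtype.val_injective.injOn
  rcases s.eq_empty_or_nonempty with rfl | hs
  · simp
  · constructor
    · rintro (rfl | h')
      · simp
      · exact h.1 h'.2
    · intro h'
      exact Or.inr ⟨hs, h.2 h'⟩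

theorem NC_mem_faces (s : Finset {g : G // g ≠ 1}) :
    s ∈ (NC G).faces ↔ s.Nonempty ∧
      (s : Set {g : G // g ≠ 1}).Pairwise fun a b => ¬ Commute a.1 b.1 := by
  rw [← NC_eq_empty_or_mem_faces]
  constructor
  · exact fun h => ⟨h.1, Or.inr h⟩
  · rintro ⟨h1, rfl | h2⟩
    · simp at h1
    · exact h2

variable [Finite G]

theorem bddAbove_card_isNonCommuting :
    BddAbove {n | ∃ s : Finset G, IsNonCommuting s ∧ s.card = n} := by
  have := Fintype.ofFinite G
  refine ⟨Fintype.card G, ?_⟩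
  rintro _ ⟨s, -, rfl⟩
  exact s.card_le_univ

theorem card_le_nc {s : Finset {g : G // g ≠ 1}}
    (h : (s : Set {g : G // g ≠ 1}).Pairwise fun a b => ¬ Commute a.1 b.1) : s.card ≤ nc G := by
  refine le_csSup bddAbove_card_isNonCommuting ⟨s.map (Function.Embedding.subtype _), ?_, by simp⟩
  rw [IsNonCommuting, Finset.coe_map]
  exact (Set.InjOn.pairwise_image Subtype.val_injective.injOn).2 h

theorem exists_card_eq_nc [Nontrivial G] : ∃ s : Finset {g : G // g ≠ 1},
    ((s : Set {g : G // g ≠ 1}).Pairwise fun a b => ¬ Commute a.1 b.1) ∧ s.card = nc G := by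
  classical
  obtain ⟨s, hs, hcard⟩ : nc G ∈ {n | ∃ s : Finset G, IsNonCommuting s ∧ s.card = n} :=
    Nat.sSup_mem ⟨0, ∅, by simp [IsNonCommuting], rfl⟩ bddAbove_card_isNonCommuting
  -- `nc` admits sets containing 1, but 1 commutes with everything, so such a set is `{1}` and any
  -- nontrivial singleton replaces it. In the trivial group there would be none.
  by_cases h1 : (1 : G) ∈ s
  · have hs1 : s = {1} := by
      refine Finset.eq_singleton_iff_unique_mem.2 ⟨h1, fun x hx => ?_⟩
      by_contra hne
      exact hs hx h1 hne (Commute.one_right x)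
    obtain ⟨g, hg⟩ := exists_ne (1 : G)
    exact ⟨{⟨g, hg⟩}, by simp, by rw [← hcard, hs1]; simp⟩
  · refine ⟨s.subtype (· ≠ 1), fun a ha b hb hab => ?_, ?_⟩
    · exact hs (by simpa using ha) (by simpa using hb) fun h => hab (Subtype.ext h)
    · rw [Finset.card_subtype, Finset.filter_true_of_mem, hcard]
      rintro x hx rfl
      exact h1 hx

end NonCommuting

theorem card_subtype_ne {α : Type*} [Finite α] (a : α) :
    Nat.card {x : α // x ≠ a} = Nat.card α - 1 := by
  classical
  have := Fintype.ofFinite α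
  rw [Nat.card_eq_fintype_card, Nat.card_eq_fintype_card, Fintype.card_subtype_compl]
  simp

/-! ## The blocks of a Frobenius group -/

section Frobenius

variable {G : Type*} [Group G] {H K : Subgroup G}

theorem mem_conjSubgroup {g x : G} : x ∈ conjSubgroup g H ↔ g⁻¹ * x * g ∈ H := by
  constructor
  · rintro ⟨h, hh, rfl⟩
    simpa [mul_assoc] using hh
  · intro h
    exact ⟨_, h, by simp [mul_assoc]⟩

theorem commute_coe_iff {a b : H} : Commute (a : G) (b : G) ↔ Commute a b :=
  ⟨fun h => Subtype.ext h.eq, fun h => congrArg Subtype.val h.eq⟩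

theorem IsFrobeniusComplement.mem_of_conj_mem (hH : IsFrobeniusComplement H) {x g : G}
    (hx : x ∈ H) (hx1 : x ≠ 1) (h : g⁻¹ * x * g ∈ H) : g ∈ H := by
  by_contra hg
  have : x ∈ H ⊓ conjSubgroup g H := ⟨hx, mem_conjSubgroup.2 h⟩
  rw [hH.inf_conj g hg] at this
  exact hx1 (Subgroup.mem_bot.1 this)

theorem IsFrobeniusKernel.mem_iff (hK : IsFrobeniusKernel H K) {x : G} :
    x ∈ K ↔ ∀ g, g⁻¹ * x * g ∈ H → x = 1 := by
  rw [← SetLike.mem_coe, hK]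
  simp [mem_conjSubgroup]

variable {ι : Type*}

/-- The nontrivial elements of the kernel and of the conjugates of the complement by the elements
`t i`, as nontrivial elements of the group. -/
def blockMap (H K : Subgroup G) (t : ι → G) :
    {k : K // k ≠ 1} ⊕ ι × {h : H // h ≠ 1} → {g : G // g ≠ 1}
  | Sum.inl k => ⟨k.1.1, fun h => k.2 (Subtype.ext h)⟩
  | Sum.inr p => ⟨t p.1 * p.2.1.1 * (t p.1)⁻¹, fun h => p.2.2 (Subtype.ext (by
      simpa using h))⟩

theorem blockMap_bijective (hH : IsFrobeniusComplement H) (hK : IsFrobeniusKernel H K) {t : ι → G}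
    (ht : Function.Bijective fun i => (t i : G ⧸ H)) : Function.Bijective (blockMap H K t) := by
  have hdisj : ∀ (k : {k : K // k ≠ 1}) (p : ι × {h : H // h ≠ 1}),
      k.1.1 ≠ t p.1 * p.2.1.1 * (t p.1)⁻¹ := by
    intro k p h
    refine k.2 (Subtype.ext (hK.mem_iff.1 k.1.2 (t p.1) ?_))
    rw [h]
    simp [mul_assoc]
  constructor
  · rintro (k | ⟨i, h⟩) (k' | ⟨j, h'⟩) heq
    · congr 1
      have h1 : k.1.1 = k'.1.1 := congrArg (fun g : {g : G // g ≠ 1} => g.1) heq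
      exact Subtype.ext (Subtype.ext h1)
    · exact absurd (congrArg Subtype.val heq) (hdisj k (j, h'))
    · exact absurd (congrArg Subtype.val heq).symm (hdisj k' (i, h))
    · have h1 : t i * h.1.1 * (t i)⁻¹ = t j * h'.1.1 * (t j)⁻¹ := congrArg Subtype.val heq
      have hij : i = j := by
        refine ht.1 (QuotientGroup.eq.2 ?_)
        -- Conjugates of `H` by `t i` and `t j` share a nontrivial element, so `(t i)⁻¹ * t j` lies
        -- in `H`.
        refine hH.mem_of_conj_mem h.1.2 (fun hh => h.2 (Subtype.ext hh)) ?_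
        have : ((t i)⁻¹ * t j)⁻¹ * h.1.1 * ((t i)⁻¹ * t j) =
            (t j)⁻¹ * (t i * h.1.1 * (t i)⁻¹) * t j := by group
        rw [this, h1]
        simp [mul_assoc]
      subst hij
      have : h = h' := Subtype.ext (Subtype.ext (by simpa using h1))
      rw [this]
  · rintro ⟨g, hg⟩
    by_cases hgK : g ∈ K
    · exact ⟨Sum.inl ⟨⟨g, hgK⟩, fun h => hg (congrArg Subtype.val h)⟩, rfl⟩
    · rw [hK.mem_iff] at hgK
      push Not at hgK
      obtain ⟨a, ha, -⟩ := hgK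
      obtain ⟨i, hi⟩ := ht.2 (a : G ⧸ H)
      -- The conjugate of `H` by `a` depends only on the coset of `a`, so `a` may be replaced by its
      -- representative.
      have hc : a⁻¹ * t i ∈ H := QuotientGroup.eq.1 hi.symm
      have hmem : (t i)⁻¹ * g * t i ∈ H := by
        have : (t i)⁻¹ * g * t i = (a⁻¹ * t i)⁻¹ * (a⁻¹ * g * a) * (a⁻¹ * t i) := by group
        rw [this]
        exact H.mul_mem (H.mul_mem (H.inv_mem hc) ha) hc
      refine ⟨Sum.inr (i, ⟨⟨_, hmem⟩, fun h => hg ?_⟩), ?_⟩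
      · have h' : (t i)⁻¹ * g * t i = 1 := congrArg Subtype.val h
        have : g = t i * ((t i)⁻¹ * g * t i) * (t i)⁻¹ := by group
        rw [this, h']
        simp
      · exact Subtype.ext (by simp [blockMap, mul_assoc])

/-- Two nontrivial elements lie in the same block and commute there. -/
def BlockCommute {A B : Type*} [Group A] [Group B] :
    {a : A // a ≠ 1} ⊕ ι × {b : B // b ≠ 1} → {a : A // a ≠ 1} ⊕ ι × {b : B // b ≠ 1} → Prop
  | Sum.inl a, Sum.inl b => Commute a.1 b.1
  | Sum.inr p, Sum.inr q => p.1 = q.1 ∧ Commute p.2.1 q.2.1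
  | _, _ => False

/-- After conjugating back by `t p.1`, the element `c` fixes a nontrivial element of `H` under
conjugation, which forces it into `H`. -/
theorem exists_blockMap_inr_of_commute (hH : IsFrobeniusComplement H) {t : ι → G}
    {p : ι × {h : H // h ≠ 1}} {c : {g : G // g ≠ 1}}
    (h : Commute (blockMap H K t (Sum.inr p)).1 c.1) :
    ∃ h', c = blockMap H K t (Sum.inr (p.1, h')) := by
  have hmem : (t p.1)⁻¹ * c.1 * t p.1 ∈ H := by
    refine hH.mem_of_conj_mem p.2.1.2 (fun hh => p.2.2 (Subtype.ext hh)) ?_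
    have h1 : t p.1 * p.2.1.1 * (t p.1)⁻¹ * c.1 = c.1 * (t p.1 * p.2.1.1 * (t p.1)⁻¹) := h.eq
    have h2 : ((t p.1)⁻¹ * c.1 * t p.1)⁻¹ * p.2.1.1 * ((t p.1)⁻¹ * c.1 * t p.1) =
        (t p.1)⁻¹ * c.1⁻¹ * (t p.1 * p.2.1.1 * (t p.1)⁻¹ * c.1) * t p.1 := by group
    rw [h2, h1]
    have h3 : (t p.1)⁻¹ * c.1⁻¹ * (c.1 * (t p.1 * p.2.1.1 * (t p.1)⁻¹)) * t p.1 = p.2.1.1 := by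
      group
    rw [h3]
    exact p.2.1.2
  refine ⟨⟨⟨_, hmem⟩, fun h => c.2 ?_⟩, Subtype.ext (by simp [blockMap, mul_assoc])⟩
  have h' : (t p.1)⁻¹ * c.1 * t p.1 = 1 := congrArg Subtype.val h
  have : c.1 = t p.1 * ((t p.1)⁻¹ * c.1 * t p.1) * (t p.1)⁻¹ := by group
  rw [this, h']
  simp

theorem commute_blockMap_iff (hH : IsFrobeniusComplement H) (hK : IsFrobeniusKernel H K)
    {t : ι → G} (ht : Function.Bijective fun i => (t i : G ⧸ H))
    (a b : {k : K // k ≠ 1} ⊕ ι × {h : H // h ≠ 1}) :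
    Commute (blockMap H K t a).1 (blockMap H K t b).1 ↔ BlockCommute a b := by
  have hinj := (blockMap_bijective hH hK ht).1
  rcases a with k | p <;> rcases b with k' | q
  · exact commute_coe_iff
  · refine ⟨fun h => ?_, False.elim⟩
    obtain ⟨h', hh⟩ := exists_blockMap_inr_of_commute hH h.symm
    exact absurd (hinj hh) (by simp)
  · refine ⟨fun h => ?_, False.elim⟩
    obtain ⟨h', hh⟩ := exists_blockMap_inr_of_commute hH h
    exact absurd (hinj hh) (by simp)
  · have key : ∀ (i : ι) (x y : {h : H // h ≠ 1}),
        Commute (blockMap H K t (Sum.inr (i, x))).1 (blockMap H K t (Sum.inr (i, y))).1 ↔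
          Commute x.1 y.1 := fun i x y => by
      change Commute (t i * x.1.1 * (t i)⁻¹) (t i * y.1.1 * (t i)⁻¹) ↔ _
      rw [Commute.conj_iff]
      exact commute_coe_iff
    obtain ⟨i, x⟩ := p
    obtain ⟨j, y⟩ := q
    constructor
    · intro h
      obtain ⟨h', hh⟩ := exists_blockMap_inr_of_commute hH h
      have := Sum.inr_injective (hinj hh)
      obtain rfl : j = i := congrArg Prod.fst this
      exact ⟨rfl, (key j x y).1 h⟩
    · rintro ⟨hij, h⟩
      obtain rfl : i = j := hij
      exact (key i x y).2 h

/-- Counting blocks gives |G| − 1 = (|K| − 1) + |G : H|(|H| − 1); Lagrange's theorem then leaves |K|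
= |G : H|. -/
theorem card_frobeniusKernel [Finite G] (hH : IsFrobeniusComplement H)
    (hK : IsFrobeniusKernel H K) : Nat.card K = Nat.card (G ⧸ H) := by
  have hbij : Function.Bijective fun q : G ⧸ H => ((Quotient.out q : G) : G ⧸ H) := by
    have : (fun q : G ⧸ H => ((Quotient.out q : G) : G ⧸ H)) = id :=
      funext fun q => QuotientGroup.out_eq' q
    rw [this]
    exact Function.bijective_id
  have h1 := Nat.card_congr (Equiv.ofBijective _ (blockMap_bijective hH hK hbij))
  rw [Nat.card_sum, Nat.card_prod, card_subtype_ne, card_subtype_ne, card_subtype_ne,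
    Subgroup.card_eq_card_quotient_mul_card_subgroup H] at h1
  have hq : 0 < Nat.card (G ⧸ H) := Nat.card_pos
  have hh : 0 < Nat.card H := Nat.card_pos
  have hk : 0 < Nat.card K := Nat.card_pos
  obtain ⟨h, hh'⟩ : ∃ h, Nat.card H = h + 1 := ⟨_, (Nat.succ_pred_eq_of_pos hh).symm⟩
  rw [hh'] at h1
  simp only [Nat.add_sub_cancel, Nat.mul_add, Nat.mul_one] at h1
  omega

theorem exists_blockEquiv [Finite G] (hH : IsFrobeniusComplement H) (hK : IsFrobeniusKernel H K) :
    ∃ E : {k : K // k ≠ 1} ⊕ Fin (Nat.card K) × {h : H // h ≠ 1} ≃ {g : G // g ≠ 1},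
      ∀ a b, Commute (E a).1 (E b).1 ↔ BlockCommute a b := by
  have hcard := card_frobeniusKernel hH hK
  have σ : Fin (Nat.card K) ≃ G ⧸ H := (finCongr hcard).trans (Finite.equivFin _).symm
  have hbij : Function.Bijective fun i => ((Quotient.out (σ i) : G) : G ⧸ H) := by
    have : (fun i => ((Quotient.out (σ i) : G) : G ⧸ H)) = σ :=
      funext fun i => QuotientGroup.out_eq' (σ i)
    rw [this]
    exact σ.bijective
  exact ⟨Equiv.ofBijective _ (blockMap_bijective hH hK hbij),
    fun a b => commute_blockMap_iff hH hK hbij a b⟩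

theorem IsFrobeniusComplement.nontrivial (hH : IsFrobeniusComplement H) : Nontrivial H :=
  (Subgroup.nontrivial_iff_ne_bot H).2 hH.ne_bot

theorem IsFrobeniusKernel.nontrivial [Finite G] (hH : IsFrobeniusComplement H)
    (hK : IsFrobeniusKernel H K) : Nontrivial K := by
  rw [← Finite.one_lt_card_iff_nontrivial, card_frobeniusKernel hH hK]
  exact Subgroup.one_lt_index_of_ne_top hH.ne_top

end Frobenius

/-! ## Joins of non-commuting complexes -/

section Join

open AbstractSimplicialComplex

variable {A B : Type*} [Group A] [Group B] {n : ℕ}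

theorem pairwise_blockCommute_iff
    (s : Finset ({a : A // a ≠ 1} ⊕ Fin n × {b : B // b ≠ 1})) :
    (s : Set ({a : A // a ≠ 1} ⊕ Fin n × {b : B // b ≠ 1})).Pairwise
        (fun x y => ¬ BlockCommute x y) ↔
      ((s.toLeft : Set {a : A // a ≠ 1}).Pairwise fun a b => ¬ Commute a.1 b.1) ∧
      ∀ i, ((slice s.toRight i : Finset _) : Set {b : B // b ≠ 1}).Pairwise
        fun a b => ¬ Commute a.1 b.1 := by
  constructor
  · refine fun h => ⟨fun a ha b hb hab => ?_, fun i a ha b hb hab hc => ?_⟩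
    · exact h (x := Sum.inl a) (by simpa using ha) (y := Sum.inl b) (by simpa using hb)
        (by simpa using hab)
    · rw [Finset.mem_coe, mem_slice, Finset.mem_toRight] at ha hb
      exact h ha hb (by simpa using hab) ⟨rfl, hc⟩
  · rintro ⟨h1, h2⟩ (a | ⟨i, a⟩) ha (b | ⟨j, b⟩) hb hab hc
    · exact h1 (by simpa using ha) (by simpa using hb) (by simpa using hab) hc
    · exact hc
    · exact hc
    · obtain ⟨hij, hc⟩ := hc
      obtain rfl : i = j := hij
      refine h2 i (x := a) ?_ (y := b) ?_ (by simpa using hab) hc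
      · rw [Finset.mem_coe, mem_slice]; simpa using ha
      · rw [Finset.mem_coe, mem_slice]; simpa using hb

theorem mem_faces_join_iff (s : Finset ({a : A // a ≠ 1} ⊕ Fin n × {b : B // b ≠ 1})) :
    s ∈ ((NC A).join ((NC B).joinPow n)).faces ↔ s.Nonempty ∧
      (s : Set ({a : A // a ≠ 1} ⊕ Fin n × {b : B // b ≠ 1})).Pairwise
        (fun x y => ¬ BlockCommute x y) := by
  rw [pairwise_blockCommute_iff]
  simp_rw [← NC_eq_empty_or_mem_faces]
  refine and_congr_right fun _ => and_congr_right fun _ => ?_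
  constructor
  · rintro (h | h) i
    · left
      ext v
      simp [mem_slice, h]
    · exact h.2 i
  · intro h
    rcases s.toRight.eq_empty_or_nonempty with h' | h'
    · exact Or.inl h'
    · exact Or.inr ⟨h', h⟩

variable {G : Type*} [Group G]

theorem pairwise_map_iff {E : {a : A // a ≠ 1} ⊕ Fin n × {b : B // b ≠ 1} ≃ {g : G // g ≠ 1}}
    (hE : ∀ a b, Commute (E a).1 (E b).1 ↔ BlockCommute a b)
    (s : Finset ({a : A // a ≠ 1} ⊕ Fin n × {b : B // b ≠ 1})) :
    ((s.map E.toEmbedding : Finset _) : Set {g : G // g ≠ 1}).Pairwise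
        (fun a b => ¬ Commute a.1 b.1) ↔
      (s : Set ({a : A // a ≠ 1} ⊕ Fin n × {b : B // b ≠ 1})).Pairwise
        (fun x y => ¬ BlockCommute x y) := by
  rw [Finset.coe_map]
  refine (Set.InjOn.pairwise_image E.injective.injOn).trans ?_
  have : (fun x y => ¬ BlockCommute x y) =
      Function.onFun (fun a b : {g : G // g ≠ 1} => ¬ Commute a.1 b.1) E :=
    funext fun x => funext fun y => propext (not_congr (hE x y).symm)
  rw [this]

theorem nonempty_iso_of_blockEquiv
    {E : {a : A // a ≠ 1} ⊕ Fin n × {b : B // b ≠ 1} ≃ {g : G // g ≠ 1}}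
    (hE : ∀ a b, Commute (E a).1 (E b).1 ↔ BlockCommute a b) :
    Nonempty (Iso (NC G) ((NC A).join ((NC B).joinPow n))) := by
  refine ⟨⟨E.symm, fun s => ?_⟩⟩
  rw [mem_faces_join_iff, NC_mem_faces, ← pairwise_map_iff hE, Finset.map_nonempty]
  have : (s.map E.symm.toEmbedding).map E.toEmbedding = s := by
    rw [Finset.map_map]; ext; simp
  rw [this]

theorem card_eq_sum_card_slice {V : Type*} (r : Finset (Fin n × V)) :
    r.card = ∑ i, (slice r i).card := by
  classical
  rw [Finset.card_eq_sum_card_fiberwise (f := Prod.fst) (t := Finset.univ) fun _ _ => by simp]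
  refine Finset.sum_congr rfl fun i _ => ?_
  have : r.filter (fun p => p.1 = i) =
      (slice r i).map ⟨fun v => (i, v), fun _ _ h => (Prod.mk.inj h).2⟩ := by
    ext ⟨j, v⟩
    simp only [Finset.mem_filter, Finset.mem_map, mem_slice]
    constructor
    · rintro ⟨h, rfl⟩
      exact ⟨v, h, rfl⟩
    · rintro ⟨u, h, huv⟩
      obtain ⟨rfl, rfl⟩ := Prod.mk.inj huv
      exact ⟨h, rfl⟩
  rw [this, Finset.card_map]

theorem nc_eq_of_blockEquiv [Finite A] [Finite B] [Finite G] [Nontrivial A] [Nontrivial B]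
    {E : {a : A // a ≠ 1} ⊕ Fin n × {b : B // b ≠ 1} ≃ {g : G // g ≠ 1}}
    (hE : ∀ a b, Commute (E a).1 (E b).1 ↔ BlockCommute a b) :
    nc G = nc A + n * nc B := by
  obtain ⟨a₀, ha₀⟩ := exists_ne (1 : A)
  have : Nontrivial G := ⟨⟨(E (Sum.inl ⟨a₀, ha₀⟩)).1, 1, (E (Sum.inl ⟨a₀, ha₀⟩)).2⟩⟩
  apply le_antisymm
  · obtain ⟨s, hs, hcard⟩ := exists_card_eq_nc (G := G)
    have hmap : (s.map E.symm.toEmbedding).map E.toEmbedding = s := by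
      rw [Finset.map_map]; ext; simp
    rw [← hmap, pairwise_map_iff hE, pairwise_blockCommute_iff] at hs
    rw [← hcard, ← Finset.card_map E.symm.toEmbedding, ← Finset.card_toLeft_add_card_toRight,
      card_eq_sum_card_slice (Finset.toRight _)]
    refine Nat.add_le_add (card_le_nc hs.1) ?_
    calc _ ≤ ∑ _i : Fin n, nc B := Finset.sum_le_sum fun i _ => card_le_nc (hs.2 i)
      _ = n * nc B := by simp
  -- A maximal set of `A` together with the same maximal set of `B` in every copy attains the bound.
  · obtain ⟨sA, hA, hcA⟩ := exists_card_eq_nc (G := A)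
    obtain ⟨sB, hB, hcB⟩ := exists_card_eq_nc (G := B)
    have hs := (pairwise_map_iff hE (sA.disjSum (Finset.univ ×ˢ sB))).2 (by
      rw [pairwise_blockCommute_iff]
      refine ⟨by simpa using hA, fun i => ?_⟩
      have : slice (sA.disjSum ((Finset.univ : Finset (Fin n)) ×ˢ sB)).toRight i = sB := by
        ext v
        simp [mem_slice]
      rwa [this])
    have := card_le_nc hs
    rw [Finset.card_map, Finset.card_disjSum, Finset.card_product, hcA, hcB] at this
    simpa using this

/-! ### The homotopy type when both factors are abelian. -/

/-- The index of the block of a nontrivial element. -/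
def blockIndex (E : {a : A // a ≠ 1} ⊕ Fin n × {b : B // b ≠ 1} ≃ {g : G // g ≠ 1})
    (v : {g : G // g ≠ 1}) : Fin (n + 1) :=
  Sum.elim (fun _ => 0) (fun p => p.1.succ) (E.symm v)

theorem nonempty_homotopyEquiv_of_blockEquiv [Finite A] [Finite B] [Finite G]
    [Nontrivial A] [Nontrivial B] (hA : ∀ a b : A, a * b = b * a) (hB : ∀ a b : B, a * b = b * a)
    {E : {a : A // a ≠ 1} ⊕ Fin n × {b : B // b ≠ 1} ≃ {g : G // g ≠ 1}}
    (hE : ∀ a b, Commute (E a).1 (E b).1 ↔ BlockCommute a b) :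
    Nonempty (ContinuousMap.HomotopyEquiv (NC G).realization
      (WedgeOfSpheres ((Nat.card A - 2) * (Nat.card B - 2) ^ n) n)) := by
  classical
  have := Fintype.ofFinite {g : G // g ≠ 1}
  obtain ⟨a, ha⟩ := exists_ne (1 : A)
  obtain ⟨b, hb⟩ := exists_ne (1 : B)
  set β := blockIndex E with hβ_def
  have hβl : ∀ x, β (E (Sum.inl x)) = 0 := fun x => by simp [hβ_def, blockIndex]
  have hβr : ∀ p, β (E (Sum.inr p)) = p.1.succ := fun p => by simp [hβ_def, blockIndex]
  have hβ : ∀ x y, Commute (E x).1 (E y).1 ↔ β (E x) = β (E y) := by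
    intro x y
    rw [hE]
    rcases x with x | p <;> rcases y with y | q
    · exact iff_of_true (hA x.1 y.1) (by rw [hβl, hβl])
    · exact iff_of_false id (by rw [hβl, hβr]; exact (Fin.succ_ne_zero q.1).symm)
    · exact iff_of_false id (by rw [hβl, hβr]; exact Fin.succ_ne_zero p.1)
    · rw [hβr, hβr, Fin.succ_inj]
      exact and_iff_left (hB p.2.1 q.2.1)
  have hfaces : ∀ s, s ∈ (NC G).faces ↔ s.Nonempty ∧ Set.InjOn β (s : Set {g : G // g ≠ 1}) := by
    intro s
    rw [NC_mem_faces]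
    refine and_congr_right fun _ => ?_
    have hβ' : ∀ x y, Commute (x : {g : G // g ≠ 1}).1 y.1 ↔ β x = β y := fun x y => by
      simpa using hβ (E.symm x) (E.symm y)
    simp only [hβ']
    exact ⟨fun h x hx y hy hxy => by_contra fun hne => h hx hy hne hxy,
      fun h x hx y hy hne hxy => hne (h hx hy hxy)⟩
  let e : Fin (n + 1) → {g : G // g ≠ 1} :=
    Fin.cons (E (Sum.inl ⟨a, ha⟩)) fun i => E (Sum.inr (i, ⟨b, hb⟩))
  have he : ∀ i, β (e i) = i := Fin.cases (hβl _) fun i => hβr _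
  -- Two elements are dropped from each factor: the identity, which is not a vertex, and the chosen
  -- vertex of the block.
  have hc0 : Nat.card {v // β v = 0 ∧ v ≠ e 0} = Nat.card A - 2 := by
    rw [← Nat.sub_sub _ 1 1, ← card_subtype_ne (1 : A), ← card_subtype_ne (⟨a, ha⟩ : {a : A // a ≠ 1})]
    refine (Nat.card_congr (Equiv.ofBijective (fun x => ⟨E (Sum.inl x.1), hβl _, fun h =>
      x.2 (Sum.inl_injective (E.injective h))⟩) ⟨fun x y h => ?_, ?_⟩)).symm
    · exact Subtype.ext (Sum.inl_injective (E.injective (congrArg Subtype.val h)))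
    · rintro ⟨v, hv, hne⟩
      obtain ⟨x | p, rfl⟩ := E.surjective v
      · exact ⟨⟨x, fun h => hne (by rw [h]; rfl)⟩, rfl⟩
      · rw [hβr] at hv
        exact absurd hv (Fin.succ_ne_zero _)
  have hcs : ∀ i : Fin n, Nat.card {v // β v = i.succ ∧ v ≠ e i.succ} = Nat.card B - 2 := by
    intro i
    rw [← Nat.sub_sub _ 1 1, ← card_subtype_ne (1 : B), ← card_subtype_ne (⟨b, hb⟩ : {b : B // b ≠ 1})]
    refine (Nat.card_congr (Equiv.ofBijective (fun x => ⟨E (Sum.inr (i, x.1)), hβr _, fun h =>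
      x.2 (congrArg Prod.snd (Sum.inr_injective (E.injective h)))⟩) ⟨fun x y h => ?_, ?_⟩)).symm
    · exact Subtype.ext (congrArg Prod.snd
        (Sum.inr_injective (E.injective (congrArg Subtype.val h))))
    · rintro ⟨v, hv, hne⟩
      obtain ⟨x | ⟨j, y⟩, rfl⟩ := E.surjective v
      · rw [hβl] at hv
        exact absurd hv.symm (Fin.succ_ne_zero _)
      · rw [hβr] at hv
        obtain rfl : j = i := Fin.succ_injective _ hv
        exact ⟨⟨y, fun h => hne (by rw [h]; rfl)⟩, rfl⟩
  have hcard : Nat.card (∀ i, {v // β v = i ∧ v ≠ e i}) =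
      (Nat.card A - 2) * (Nat.card B - 2) ^ n := by
    rw [Nat.card_pi, Fin.prod_univ_succ, hc0]
    simp_rw [hcs]
    rw [Finset.prod_const, Finset.card_univ, Fintype.card_fin]
  -- The spheres are indexed by the choices of a vertex other than `e i` in every block. If some
  -- block has a single vertex there are none, and the empty wedge needs no separate treatment.
  let σ := (Finite.equivFinOfCardEq hcard).symm
  rw [Multipartite.realization_eq_points hfaces]
  refine Multipartite.nonempty_points_homotopyEquiv he (φ := fun k i => (σ k i).1)
    (fun k i => (σ k i).2.1) (fun k i => (σ k i).2.2) (fun k l h => ?_) fun f hf hne => ?_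
  · exact σ.injective (funext fun i => Subtype.ext (congrFun h i))
  · obtain ⟨k, hk⟩ := σ.surjective fun i => ⟨f i, hf i, hne i⟩
    exact ⟨k, funext fun i => by rw [hk]⟩

end Join

theorem mainTheorem9 {G : Type*} [Group G] [Finite G] (H K : Subgroup G)
    (hH : IsFrobeniusComplement H) (hK : IsFrobeniusKernel H K) :
    Nonempty (AbstractSimplicialComplex.Iso (NC G) ((NC K).join ((NC H).joinPow (Nat.card K)))) ∧
    nc G = nc K + Nat.card K * nc H ∧
    ((∀ a b : H, a * b = b * a) → (∀ a b : K, a * b = b * a) →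
      Nonempty (ContinuousMap.HomotopyEquiv (NC G).realization
        (WedgeOfSpheres ((Nat.card K - 2) * (Nat.card H - 2) ^ Nat.card K) (Nat.card K)))) := by
  obtain ⟨E, hE⟩ := exists_blockEquiv hH hK
  have := hH.nontrivial
  have := hK.nontrivial hH
  exact ⟨nonempty_iso_of_blockEquiv hE, nc_eq_of_blockEquiv hE,
    fun hHc hKc => nonempty_homotopyEquiv_of_blockEquiv hKc hHc hE⟩
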